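/- Let $V$ be a commutative unital quantale with tensor $\otimes$, unit $k$ and internal hom $\multimap$ ($z\le u\multimap v\iff z\otimes u\le v$). Let $\mathcal T=(\mathbb T,V,\xi)$ be a strict topological theory. This means that $\mathbb T=(T,e,m)$ is a monad on $\mathbf{Set}$ such that $T$ sends pullbacks to weak pullbacks and every naturality square of $m$ is a weak pullback, and that $\xi:TV\to V$ is a map with $\xi e_V=1_V$, $\xi\,T\xi=\xi m_V$, $\xi\,T(\otimes)=\otimes\,\langle\xi\,T\pi_1,\xi\,T\pi_2\rangle$ and $\xi\,T(k)=k\,!$ on $T1$, such that the maps $V^X\to V^{TX}$, $\varphi\mapsto\xi\cdot T\varphi$, are monotone and natural in $X$ with respect to the covariant functor $P_VX=V^X$, $P_V(f)(\varphi)(y)=\bigvee_{f(x)=y}\varphi(x)$. Moreover $T1=1$ is assumed. **Notions.** For $r:X\times Y\to V$ put $T_\xi r(\mathfrak x,\mathfrak y)=\bigvee\{\xi\,Tr(\mathfrak w)\mid \mathfrak w\in T(X\times Y),\,T\pi_1\mathfrak w=\mathfrak x,\,T\pi_2\mathfrak w=\mathfrak y\}$. A $\mathcal T$-relation $a$ from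 $X$ to $Y$ is a map $a:TX\times Y\to V$. With $b$ from $Y$ to $Z$, $(b\circ a)(\mathfrak x,z)=\bigvee_{m_X(\mathfrak X)=\mathfrak x}\bigvee_{\mathfrak y\in TY}T_\xi a(\mathfrak X,\mathfrak y)\otimes b(\mathfrak y,z)$. A $\mathcal T$-category $(X,a)$ is a set $X$ with a $\mathcal T$-relation $a$ from $X$ to $X$ such that $k\le a(e_X(x),x)$ and $T_\xi a(\mathfrak X,\mathfrak x)\otimes a(\mathfrak x,x)\le a(m_X(\mathfrak X),x)$. A $\mathcal T$-functor $f:(X,a)\to(Y,b)$ is a map with $a(\mathfrak x,x)\le b(Tf(\mathfrak x),f(x))$; it is fully faithful if equality always holds, and a full embedding if it is moreover injective. Put $f_*(\mathfrak x,y)=b(Tf(\mathfrak x),y)$ and $f^*(\mathfrak y,x)=b(\mathfrak y,f(x))$. Write $f\le g$ if $f^*\le g^*$ pointwise, and $f\cong g$ if $f\le g$ and $g\le f$; points $x,y$ of $Y$ are compared in the same way, as maps $1\to Y$. A $\mathcal T$-module $\varphi$ from $(X,a)$ to $(Y,b)$ is a $\mathcal T$-relation with $\varphi\circ a\le\varphi$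 and $b\circ\varphi\le\varphi$. For $\mathcal T$-modules $\varphi$ from $(X,a)$ to $(Y,b)$ and $\psi$ from $(Y,b)$ to $(X,a)$, $\varphi\dashv\psi$ means $a\le\psi\circ\varphi$ and $\varphi\circ\psi\le b$. A $\mathcal T$-category $X$ is *L-separated* if $f\cong g$ implies $f=g$ for all $\mathcal T$-functors $f,g:Z\to X$ and all $Z$. It is *L-complete* if for every $Z$ every adjunction $\varphi\dashv\psi$ of $\mathcal T$-modules, with $\varphi$ from $Z$ to $X$, is of the form $f_*\dashv f^*$ for a $\mathcal T$-functor $f:Z\to X$. A $\mathcal T$-functor $f:X\to(Y,b)$ is *L-dense* if $f_*\circ f^*=b$. The *L-closure* of $M\subseteq X$ is the set of all $x\in X$ such that $f(x)\cong g(x)$ for all $\mathcal T$-functors $f,g:X\to Y$ (and all $Y$) with $f|_M=g|_M$. Let $X=(X,a)$ be a $\mathcal T$-category. Regard $V$ as a $\mathcal T$-category with structure $(\mathfrak v,v)\mapsto\xi(\mathfrak v)\multimap v$. Let $|X|$ be the set $TX$ with the structure whose value at $(\mathfrak X,\mathfrak x)$ is $k$ if $m_X(\mathfrak X)=\mathfrak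 x$ and $\bot$ otherwise. Let $X^{\mathrm{op}}$ be the set $TX$ with structure $(\mathfrak X,\mathfrak x)\mapsto T_\xi(r^\circ)(\mathfrak X,e_{TX}(\mathfrak x))$, where $r(\mathfrak x,\mathfrak y)=\bigvee_{m_X(\mathfrak X)=\mathfrak x}T_\xi a(\mathfrak X,\mathfrak y)$ and $r^\circ(\mathfrak x,\mathfrak y)=r(\mathfrak y,\mathfrak x)$. Let $|X|\multimap V$ be the set of $\mathcal T$-functors $|X|\to V$ with structure $$(\mathfrak p,h)\mapsto\bigwedge_{\mathfrak q\in T(TX\times(|X|\multimap V)),\ T\pi_2(\mathfrak q)=\mathfrak p}\ \bigl(\xi\,T\mathrm{ev}(\mathfrak q)\multimap h(m_X(T\pi_1(\mathfrak q)))\bigr).$$ Let $\hat X\subseteq(|X|\multimap V)$, with the restricted structure, consist of those $\psi$ that are also $\mathcal T$-functors $X^{\mathrm{op}}\to V$. Let $y:X\to\hat X$, $x\mapsto a(-,x)$, be the Yoneda functor, and let $\tilde X$ be the L-closure of $y(X)$ in $\hat X$, with the restricted structure. **Theorem.** 1. The full subcategory of L-complete objects in the category of L-separated $\mathcal T$-categories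 and $\mathcal T$-functors is epi-reflective: its inclusion functor has a left adjoint, and all components of the unit are epimorphisms of L-separated $\mathcal T$-categories. 2. If $X$ is L-separated, $Y$ is L-complete and L-separated, and $j:X\to Y$ is a full L-dense embedding, then $j$ is a reflection map: for every L-complete L-separated $Z$ and every $\mathcal T$-functor $f:X\to Z$ there is exactly one $\mathcal T$-functor $g:Y\to Z$ with $g\cdot j=f$. 3. In particular, for every L-separated $X$, $y:X\to\tilde X$ is a full L-dense embedding, $\tilde X$ is L-complete and L-separated, and $y:X\to\tilde X$ is a reflection map. -/

import Mathlib

open CategoryTheory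

universe u

/-! ## Monads on the category of sets, elementwise -/

namespace SetMonad

section

variable (T : Monad (Type u)) {X Y Z : Type u}

/-- The action `Tf : TX → TY` of the functor part. -/
def map (f : X → Y) : T.obj X → T.obj Y := fun t => T.map (↾f) t

/-- The unit `e_X : X → TX`. -/
def e : X → T.obj X := fun x => T.η.app X x

/-- The multiplication `m_X : TTX → TX`. -/
def m : T.obj (T.obj X) → T.obj X := fun t => T.μ.app X t

theorem map_id (t : T.obj X) : map T (fun x : X => x) t = t := by
  have h := T.toFunctor.map_id X
  exact congrArg (fun k : T.obj X ⟶ T.obj X => k t) h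

theorem map_map (f : X → Y) (g : Y → Z) (t : T.obj X) :
    map T g (map T f t) = map T (fun x => g (f x)) t := by
  have h := T.toFunctor.map_comp (↾f) (↾g)
  exact (congrArg (fun k : T.obj X ⟶ T.obj Z => k t) h).symm

theorem map_e (f : X → Y) (x : X) : map T f (e T x) = e T (f x) := by
  have h := T.η.naturality (↾f)
  exact (congrArg (fun k : X ⟶ T.obj Y => k x) h).symm

theorem m_map_map (f : X → Y) (t : T.obj (T.obj X)) :
    m T (map T (map T f) t) = map T f (m T t) := by
  have h := T.μ.naturality (↾f)
  exact congrArg (fun k : T.obj (T.obj X) ⟶ T.obj Y => k t) h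

theorem m_e (t : T.obj X) : m T (e T t) = t := by
  have h := T.left_unit X
  exact congrArg (fun k : T.obj X ⟶ T.obj X => k t) h

theorem m_map_e (t : T.obj X) : m T (map T (e T) t) = t := by
  have h := T.right_unit X
  exact congrArg (fun k : T.obj X ⟶ T.obj X => k t) h

theorem m_map_m (t : T.obj (T.obj (T.obj X))) : m T (map T (m T) t) = m T (m T t) := by
  have h := T.assoc X
  exact congrArg (fun k : T.obj (T.obj (T.obj X)) ⟶ T.obj X => k t) h

end

end SetMonad

/-- A square of sets `p : P → A`, `q : P → B`, `f : A → C`, `g : B → C` is a weak pullback: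
it commutes, and every pair `(a, b)` with `f a = g b` comes from a (not necessarily unique)
element of `P`. -/
def IsWeakPullbackSq {P A B C : Type u} (p : P → A) (q : P → B) (f : A → C) (g : B → C) : Prop :=
  (∀ x, f (p x) = g (q x)) ∧ ∀ a b, f a = g b → ∃ x, p x = a ∧ q x = b

/-! ## Strict topological theories -/

/-- A strict topological theory `(T, V, ξ)` over the commutative unital quantale `V`
(tensor `*`, unit `1`). -/
structure StrictTopologicalTheory (V : Type u) [CompleteLattice V] [CommMonoid V]
    [IsQuantale V] where
  /-- the monad `(T, e, m)` on the category of sets -/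
  monad : Monad (Type u)
  /-- `T` sends pullbacks to weak pullbacks -/
  map_weakPullback : ∀ {P A B C : Type u} (p : P → A) (q : P → B) (f : A → C) (g : B → C),
    IsPullback (↾p) (↾q) (↾f) (↾g) →
      IsWeakPullbackSq (SetMonad.map monad p) (SetMonad.map monad q)
        (SetMonad.map monad f) (SetMonad.map monad g)
  /-- the naturality squares of `m` are weak pullbacks -/
  m_weakPullback : ∀ {X Y : Type u} (f : X → Y),
    IsWeakPullbackSq (SetMonad.m monad) (SetMonad.map monad (SetMonad.map monad f))
      (SetMonad.map monad f) (SetMonad.m monad)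
  /-- the structure map `ξ : TV → V` -/
  ξ : monad.obj V → V
  ξ_e : ∀ v : V, ξ (SetMonad.e monad v) = v
  ξ_m : ∀ t : monad.obj (monad.obj V), ξ (SetMonad.map monad ξ t) = ξ (SetMonad.m monad t)
  /-- compatibility of `ξ` with the tensor product -/
  ξ_mul : ∀ w : monad.obj (V × V),
    ξ (SetMonad.map monad (fun p : V × V => p.1 * p.2) w) =
      ξ (SetMonad.map monad Prod.fst w) * ξ (SetMonad.map monad Prod.snd w)
  /-- compatibility of `ξ` with the unit -/
  ξ_one : ∀ t : monad.obj PUnit.{u + 1},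
    ξ (SetMonad.map monad (fun _ : PUnit.{u + 1} => (1 : V)) t) = 1
  /-- the components `φ ↦ ξ · Tφ` of `P_V ⟶ P_V T` are monotone -/
  ξ_mono : ∀ {X : Type u} (φ φ' : X → V), φ ≤ φ' → ∀ t : monad.obj X,
    ξ (SetMonad.map monad φ t) ≤ ξ (SetMonad.map monad φ' t)
  /-- `φ ↦ ξ · Tφ` is natural as a transformation `P_V ⟶ P_V T`, where `P_V X = (X → V)` and
  `P_V f φ y = ⨆ x ∈ f⁻¹ y, φ x` -/
  ξ_nat : ∀ {X Y : Type u} (f : X → Y) (φ : X → V) (t : monad.obj Y),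
    ξ (SetMonad.map monad (fun y => ⨆ x : {x : X // f x = y}, φ x) t) =
      ⨆ s : {s : monad.obj X // SetMonad.map monad f s = t}, ξ (SetMonad.map monad φ s)
  /-- `T1 = 1` -/
  T_one : Nonempty (Unique (monad.obj PUnit.{u + 1}))

namespace StrictTopologicalTheory

section

variable {V : Type u} [CompleteLattice V] [CommMonoid V] [IsQuantale V]
variable (Θ : StrictTopologicalTheory V) {W X Y Z : Type u}

/-- `TX` -/
abbrev T (X : Type u) : Type u := Θ.monad.obj X

/-- `Tf` -/
def map (f : X → Y) : Θ.T X → Θ.T Y := SetMonad.map Θ.monad f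

/-- `e_X` -/
def e : X → Θ.T X := SetMonad.e Θ.monad

/-- `m_X` -/
def m : Θ.T (Θ.T X) → Θ.T X := SetMonad.m Θ.monad

/-- The extension of the functor `T` to `V`-relations. -/
def Tξ (r : X → Y → V) : Θ.T X → Θ.T Y → V := fun x y =>
  ⨆ w : {w : Θ.T (X × Y) // Θ.map Prod.fst w = x ∧ Θ.map Prod.snd w = y},
    Θ.ξ (Θ.map (fun p : X × Y => r p.1 p.2) w)

/-- The Kleisli convolution `b ∘ a = b · Tξ a · m°` of `a : X ⇀ Y` and `b : Y ⇀ Z`, where a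
`T`-relation `X ⇀ Y` is a `V`-relation from `TX` to `Y`. -/
def kleisli (b : Θ.T Y → Z → V) (a : Θ.T X → Y → V) : Θ.T X → Z → V := fun x z =>
  ⨆ t : {t : Θ.T (Θ.T X) // Θ.m t = x}, ⨆ y : Θ.T Y, Θ.Tξ a t y * b y z

/-- The defining conditions on the structure of a `T`-category. -/
structure IsTCategory (a : Θ.T X → X → V) : Prop where
  refl : ∀ x : X, 1 ≤ a (Θ.e x) x
  trans : ∀ (t : Θ.T (Θ.T X)) (s : Θ.T X) (x : X), Θ.Tξ a t s * a s x ≤ a (Θ.m t) x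

/-- The condition on a map `(X, a) → (Y, b)` to be a `T`-functor. -/
def IsTFunctor (a : Θ.T X → X → V) (b : Θ.T Y → Y → V) (f : X → Y) : Prop :=
  ∀ (t : Θ.T X) (x : X), a t x ≤ b (Θ.map f t) (f x)

/-! ### Auxiliary facts -/

theorem map_id (t : Θ.T X) : Θ.map (fun x : X => x) t = t := SetMonad.map_id Θ.monad t

theorem map_map (f : X → Y) (g : Y → Z) (t : Θ.T X) :
    Θ.map g (Θ.map f t) = Θ.map (fun x => g (f x)) t := SetMonad.map_map Θ.monad f g t

theorem map_e (f : X → Y) (x : X) : Θ.map f (Θ.e x) = Θ.e (f x) := SetMonad.map_e Θ.monad f x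

theorem m_map_map (f : X → Y) (t : Θ.T (Θ.T X)) :
    Θ.m (Θ.map (Θ.map f) t) = Θ.map f (Θ.m t) := SetMonad.m_map_map Θ.monad f t

theorem m_e (t : Θ.T X) : Θ.m (Θ.e t) = t := SetMonad.m_e Θ.monad t

theorem m_map_e (t : Θ.T X) : Θ.m (Θ.map Θ.e t) = t := SetMonad.m_map_e Θ.monad t

theorem m_map_m (t : Θ.T (Θ.T (Θ.T X))) : Θ.m (Θ.map Θ.m t) = Θ.m (Θ.m t) :=
  SetMonad.m_map_m Θ.monad t

theorem exists_m_lift (f : X → Y) (s : Θ.T X) (t : Θ.T (Θ.T Y)) (h : Θ.map f s = Θ.m t) :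
    ∃ w : Θ.T (Θ.T X), Θ.m w = s ∧ Θ.map (Θ.map f) w = t :=
  (Θ.m_weakPullback f).2 s t h

theorem mul_le_mul_V {p q r s : V} (h₁ : p ≤ q) (h₂ : r ≤ s) : p * r ≤ q * s :=
  mul_le_mul' h₁ h₂

theorem hom_iff {p q r : V} : p ≤ Quantale.leftMulResiduation q r ↔ p * q ≤ r :=
  Quantale.leftMulResiduation_le_iff_mul_le

theorem iSup_mul_le {ι : Sort*} {f : ι → V} {q r : V} (h : ∀ i, f i * q ≤ r) :
    (⨆ i, f i) * q ≤ r := by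
  rw [← hom_iff]
  exact iSup_le fun i => hom_iff.2 (h i)

theorem mul_iSup_le {ι : Sort*} {f : ι → V} {q r : V} (h : ∀ i, q * f i ≤ r) :
    q * (⨆ i, f i) ≤ r := by
  rw [mul_comm]
  exact iSup_mul_le fun i => by rw [mul_comm]; exact h i

theorem ξ_map_ξ (t : Θ.T (Θ.T V)) : Θ.ξ (Θ.map Θ.ξ t) = Θ.ξ (Θ.m t) := Θ.ξ_m t

theorem ξ_map_mul (w : Θ.T (V × V)) :
    Θ.ξ (Θ.map (fun p : V × V => p.1 * p.2) w) =
      Θ.ξ (Θ.map Prod.fst w) * Θ.ξ (Θ.map Prod.snd w) := Θ.ξ_mul w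

theorem ξ_map_mono (φ φ' : X → V) (h : ∀ x, φ x ≤ φ' x) (t : Θ.T X) :
    Θ.ξ (Θ.map φ t) ≤ Θ.ξ (Θ.map φ' t) := Θ.ξ_mono φ φ' h t

theorem ξ_map_iSup (f : X → Y) (φ : X → V) (t : Θ.T Y) :
    Θ.ξ (Θ.map (fun y => ⨆ x : {x : X // f x = y}, φ x) t) =
      ⨆ s : {s : Θ.T X // Θ.map f s = t}, Θ.ξ (Θ.map φ s) := Θ.ξ_nat f φ t

theorem map_const (x : X) (t : Θ.T W) : Θ.map (fun _ : W => x) t = Θ.e x := by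
  obtain ⟨h⟩ := Θ.T_one
  have h1 : Θ.map (fun _ : W => x) t =
      Θ.map (fun _ : PUnit.{u + 1} => x) (Θ.map (fun _ : W => PUnit.unit) t) :=
    (Θ.map_map (fun _ : W => PUnit.unit) (fun _ : PUnit.{u + 1} => x) t).symm
  rw [h1, Subsingleton.elim (Θ.map (fun _ : W => PUnit.unit) t) (Θ.e PUnit.unit)]
  exact Θ.map_e _ _

theorem ξ_const (v : V) (t : Θ.T W) : Θ.ξ (Θ.map (fun _ : W => v) t) = v := by
  rw [map_const]; exact Θ.ξ_e v

theorem ξ_mul_map (φ ψ : W → V) (t : Θ.T W) :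
    Θ.ξ (Θ.map φ t) * Θ.ξ (Θ.map ψ t) = Θ.ξ (Θ.map (fun w => φ w * ψ w) t) := by
  have h := Θ.ξ_map_mul (Θ.map (fun w => (φ w, ψ w)) t)
  simp only [map_map] at h
  exact h.symm

theorem ξ_m_map (φ : W → V) (t : Θ.T (Θ.T W)) :
    Θ.ξ (Θ.map φ (Θ.m t)) = Θ.ξ (Θ.map (fun s => Θ.ξ (Θ.map φ s)) t) := by
  have h := Θ.ξ_map_ξ (Θ.map (Θ.map φ) t)
  rw [m_map_map, map_map] at h
  exact h.symm

theorem exists_lift (f : X → Z) (g : Y → Z) (s : Θ.T X) (t : Θ.T Y)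
    (h : Θ.map f s = Θ.map g t) :
    ∃ w : Θ.T {p : X × Y // f p.1 = g p.2},
      Θ.map (fun p => p.1.1) w = s ∧ Θ.map (fun p => p.1.2) w = t := by
  refine (Θ.map_weakPullback (P := {p : X × Y // f p.1 = g p.2})
    (fun p => p.1.1) (fun p => p.1.2) f g ?_).2 s t h
  rw [Limits.Types.isPullback_iff]
  refine ⟨?_, ?_, ?_⟩
  · ext p; exact p.2
  · intro p q h1
    exact Subtype.ext (Prod.ext h1.1 h1.2)
  · intro x y hxy
    exact ⟨⟨(x, y), hxy⟩, rfl, rfl⟩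

theorem le_Tξ (r : X → Y → V) (f : W → X) (g : W → Y) (t : Θ.T W) :
    Θ.ξ (Θ.map (fun w => r (f w) (g w)) t) ≤ Θ.Tξ r (Θ.map f t) (Θ.map g t) := by
  have h := le_iSup (fun w : {w : Θ.T (X × Y) // Θ.map Prod.fst w = Θ.map f t ∧
      Θ.map Prod.snd w = Θ.map g t} => Θ.ξ (Θ.map (fun p : X × Y => r p.1 p.2) w))
    ⟨Θ.map (fun w => (f w, g w)) t, by simp only [map_map], by
      simp only [map_map]⟩
  simp only [map_map] at h
  exact h

theorem Tξ_mul_le {r : X → Y → V} {s : Y → Z → V} {x : Θ.T X} {y : Θ.T Y} {z : Θ.T Z}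
    {q : X → Z → V} (hq : ∀ x y z, r x y * s y z ≤ q x z) :
    Θ.Tξ r x y * Θ.Tξ s y z ≤ Θ.Tξ q x z := by
  refine iSup_mul_le fun w => mul_iSup_le fun w' => ?_
  obtain ⟨w, hw1, hw2⟩ := w
  obtain ⟨w', hw1', hw2'⟩ := w'
  obtain ⟨t, ht1, ht2⟩ := Θ.exists_lift (Prod.snd : X × Y → Y) (Prod.fst : Y × Z → Y) w w'
    (hw2.trans hw1'.symm)
  have h1 : x = Θ.map (fun p => p.1.1.1) t := by
    rw [← hw1, ← ht1, map_map]
  have h2 : z = Θ.map (fun p => p.1.2.2) t := by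
    rw [← hw2', ← ht2, map_map]
  refine le_trans ?_ ((Θ.le_Tξ q _ _ t).trans_eq (by rw [h1, h2]))
  dsimp only
  rw [← ht1, ← ht2]
  simp only [map_map]
  rw [ξ_mul_map]
  refine Θ.ξ_map_mono _ _ (fun p => ?_) t
  have hp := p.2
  have := hq p.1.1.1 p.1.1.2 p.1.2.2
  rw [hp] at this ⊢
  exact this

theorem Tξ_comap_le (r : X → Y → V) (f : W → X) (g : Z → Y) (w : Θ.T W) (z : Θ.T Z) :
    Θ.Tξ (fun a b => r (f a) (g b)) w z ≤ Θ.Tξ r (Θ.map f w) (Θ.map g z) := by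
  refine iSup_le fun t => ?_
  obtain ⟨t, rfl, rfl⟩ := t
  simp only [map_map]
  exact Θ.le_Tξ r (fun p : W × Z => f p.1) (fun p : W × Z => g p.2) t

theorem Tξ_Tξ_le (r : X → Y → V) (x : Θ.T (Θ.T X)) (y : Θ.T (Θ.T Y)) :
    Θ.Tξ (Θ.Tξ r) x y ≤ Θ.Tξ r (Θ.m x) (Θ.m y) := by
  refine iSup_le fun t => ?_
  obtain ⟨t, rfl, rfl⟩ := t
  -- choose witnesses through naturality of `ξ`
  have h := Θ.ξ_map_iSup (X := Θ.T (X × Y)) (Y := Θ.T X × Θ.T Y)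
    (fun w => (Θ.map Prod.fst w, Θ.map Prod.snd w))
    (fun w => Θ.ξ (Θ.map (fun p : X × Y => r p.1 p.2) w)) t
  have h' : (fun p : Θ.T X × Θ.T Y => Θ.Tξ r p.1 p.2) = fun p : Θ.T X × Θ.T Y =>
      ⨆ w : {w : Θ.T (X × Y) // (Θ.map Prod.fst w, Θ.map Prod.snd w) = p},
        Θ.ξ (Θ.map (fun p : X × Y => r p.1 p.2) w) := by
    funext p
    refine le_antisymm (iSup_le fun w => ?_) (iSup_le fun w => ?_)
    · exact le_iSup (fun w : {w : Θ.T (X × Y) // (Θ.map Prod.fst w, Θ.map Prod.snd w) = p} =>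
        Θ.ξ (Θ.map (fun p : X × Y => r p.1 p.2) w)) ⟨w.1, Prod.ext w.2.1 w.2.2⟩
    · exact le_iSup (fun w : {w : Θ.T (X × Y) // Θ.map Prod.fst w = p.1 ∧
        Θ.map Prod.snd w = p.2} => Θ.ξ (Θ.map (fun p : X × Y => r p.1 p.2) w))
        ⟨w.1, (Prod.ext_iff.1 w.2).1, (Prod.ext_iff.1 w.2).2⟩
  dsimp only at h h' ⊢
  rw [h', h]
  refine iSup_le fun s => ?_
  obtain ⟨s, rfl⟩ := s
  rw [← ξ_m_map]
  simp only [map_map]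
  have e1 : Θ.m (Θ.map (fun w : Θ.T (X × Y) => Θ.map Prod.fst w) s) = Θ.map Prod.fst (Θ.m s) :=
    Θ.m_map_map _ s
  have e2 : Θ.m (Θ.map (fun w : Θ.T (X × Y) => Θ.map Prod.snd w) s) = Θ.map Prod.snd (Θ.m s) :=
    Θ.m_map_map _ s
  rw [e1, e2]
  exact Θ.le_Tξ r Prod.fst Prod.snd (Θ.m s)

theorem Tξ_m_le (r : X → Y → V) (x : Θ.T X) (y : Θ.T (Θ.T Y)) :
    Θ.Tξ r x (Θ.m y) ≤ ⨆ t : {t : Θ.T (Θ.T X) // Θ.m t = x}, Θ.Tξ (Θ.Tξ r) t y := by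
  refine iSup_le fun w => ?_
  obtain ⟨w, rfl, hw⟩ := w
  obtain ⟨s, rfl, rfl⟩ := Θ.exists_m_lift (Prod.snd : X × Y → Y) w y hw
  refine le_trans ?_ (le_iSup (fun t : {t : Θ.T (Θ.T X) // Θ.m t = Θ.map Prod.fst (Θ.m s)} =>
    Θ.Tξ (Θ.Tξ r) t (Θ.map (Θ.map Prod.snd) s))
    ⟨Θ.map (Θ.map Prod.fst) s, Θ.m_map_map _ s⟩)
  dsimp only
  rw [ξ_m_map]
  refine le_trans (Θ.ξ_map_mono _ _ (fun v => ?_) s) (Θ.le_Tξ (Θ.Tξ r) _ _ s)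
  exact Θ.le_Tξ r Prod.fst Prod.snd v

theorem one_le_Tξ (r : X → Y → V) (f : W → X) (g : W → Y) (h : ∀ w, 1 ≤ r (f w) (g w))
    (t : Θ.T W) : 1 ≤ Θ.Tξ r (Θ.map f t) (Θ.map g t) := by
  refine le_trans ?_ (Θ.le_Tξ r f g t)
  refine le_trans ?_ (Θ.ξ_map_mono (fun _ => 1) _ (fun w => h w) t)
  rw [ξ_const]

end

/-! ## The category of `T`-categories and `T`-functors -/

section

variable {V : Type u} [CompleteLattice V] [CommMonoid V] [IsQuantale V]

/-- A `T`-category. -/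
structure TCat (Θ : StrictTopologicalTheory V) where
  carrier : Type u
  str : Θ.T carrier → carrier → V
  isTCategory : Θ.IsTCategory str

variable {Θ : StrictTopologicalTheory V}

namespace TCat

/-- A `T`-functor between `T`-categories. -/
@[ext]
structure Hom (X Y : TCat Θ) where
  toFun : X.carrier → Y.carrier
  isTFunctor : Θ.IsTFunctor X.str Y.str toFun

instance : Category (TCat Θ) where
  Hom := Hom
  id X := ⟨fun x => x, fun t x => by rw [map_id]⟩
  comp f g := ⟨fun x => g.toFun (f.toFun x), fun t x => by
    have h := (f.isTFunctor t x).trans (g.isTFunctor _ _)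
    rwa [map_map] at h⟩

/-- `f_* = b · Tf`, for a map `f` into a `T`-category `(Y, b)`. -/
def lowerStar {X : Type u} (Y : TCat Θ) (f : X → Y.carrier) : Θ.T X → Y.carrier → V :=
  fun t y => Y.str (Θ.map f t) y

/-- `f^* = f° · b`, for a map `f` into a `T`-category `(Y, b)`. -/
def upperStar {X : Type u} (Y : TCat Θ) (f : X → Y.carrier) : Θ.T Y.carrier → X → V :=
  fun t x => Y.str t (f x)

/-- The order on maps into a `T`-category: `f ≤ g` means `f^* ≤ g^*`. -/
def MapLE {X : Type u} (Y : TCat Θ) (f g : X → Y.carrier) : Prop :=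
  ∀ t x, Y.upperStar f t x ≤ Y.upperStar g t x

/-- Equivalence `f ≅ g` of maps into a `T`-category. -/
def MapEquiv {X : Type u} (Y : TCat Θ) (f g : X → Y.carrier) : Prop :=
  Y.MapLE f g ∧ Y.MapLE g f

/-- `T`-modules `φ` from `X` to `Y`. -/
def IsTModule (X Y : TCat Θ) (φ : Θ.T X.carrier → Y.carrier → V) : Prop :=
  (∀ t y, Θ.kleisli φ X.str t y ≤ φ t y) ∧ (∀ t y, Θ.kleisli Y.str φ t y ≤ φ t y)

/-- The adjunction `φ ⊣ ψ` of `T`-modules, with `φ` from `X` to `Y` and `ψ` from `Y` to `X`. -/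
def ModuleAdj (X Y : TCat Θ) (φ : Θ.T X.carrier → Y.carrier → V)
    (ψ : Θ.T Y.carrier → X.carrier → V) : Prop :=
  IsTModule X Y φ ∧ IsTModule Y X ψ ∧
    (∀ t x, X.str t x ≤ Θ.kleisli ψ φ t x) ∧ (∀ t y, Θ.kleisli φ ψ t y ≤ Y.str t y)

/-- L-separated: the order on `T`-functors into `X` is antisymmetric. -/
def LSeparated (X : TCat Θ) : Prop :=
  ∀ (Y : TCat Θ) (f g : Y ⟶ X), X.MapLE f.toFun g.toFun → X.MapLE g.toFun f.toFun → f = g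

/-- L-complete: every adjunction `φ ⊣ ψ` of `T`-modules, with `φ` into `X`, is of the form
`f_* ⊣ f^*` for a `T`-functor `f`. -/
def LComplete (X : TCat Θ) : Prop :=
  ∀ (Z : TCat Θ) (φ : Θ.T Z.carrier → X.carrier → V) (ψ : Θ.T X.carrier → Z.carrier → V),
    ModuleAdj Z X φ ψ → ∃ f : Z ⟶ X, φ = X.lowerStar f.toFun ∧ ψ = X.upperStar f.toFun

/-- L-dense `T`-functors: `f_* ∘ f^*` is the identity module on the codomain. -/
def LDense {X Y : TCat Θ} (f : X ⟶ Y) : Prop :=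
  Θ.kleisli (Y.lowerStar f.toFun) (Y.upperStar f.toFun) = Y.str

/-- Fully faithful `T`-functors. -/
def FullyFaithful {X Y : TCat Θ} (f : X ⟶ Y) : Prop :=
  ∀ t x, X.str t x = Y.str (Θ.map f.toFun t) (f.toFun x)

/-- Full embeddings: injective fully faithful `T`-functors. -/
def FullEmbedding {X Y : TCat Θ} (f : X ⟶ Y) : Prop :=
  FullyFaithful f ∧ Function.Injective f.toFun

/-- The L-closure of a subset `M` of a `T`-category `X`; points of `Y` are compared as maps
from a singleton. -/
def lClosure (X : TCat Θ) (M : Set X.carrier) : Set X.carrier :=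
  {x | ∀ (Y : TCat Θ) (f g : X ⟶ Y), (∀ y ∈ M, f.toFun y = g.toFun y) →
    Y.MapEquiv (fun _ : PUnit.{u + 1} => f.toFun x) (fun _ : PUnit.{u + 1} => g.toFun x)}

/-- A subset of a `T`-category, with the restricted structure. -/
abbrev sub (X : TCat Θ) (M : Set X.carrier) : TCat Θ where
  carrier := M
  str t x := X.str (Θ.map Subtype.val t) x.1
  isTCategory :=
    { refl := fun x => by
        rw [map_e]; exact X.isTCategory.refl x.1
      trans := fun t s x => by
        rw [← Θ.m_map_map]
        refine le_trans (mul_le_mul_V ?_ le_rfl) (X.isTCategory.trans _ (Θ.map Subtype.val s) x.1)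
        exact Θ.Tξ_comap_le X.str (Θ.map Subtype.val) Subtype.val t s }

/-- The free algebra `|X| = (TX, m_X)`, with the map `m_X` regarded as a `T`-relation. -/
abbrev free (Θ : StrictTopologicalTheory V) (X : Type u) : TCat Θ where
  carrier := Θ.T X
  str t x := ⨆ _ : Θ.m t = x, (1 : V)
  isTCategory :=
    { refl := fun x => le_iSup (fun _ : Θ.m (Θ.e x) = x => (1 : V)) (Θ.m_e x)
      trans := fun t s x => by
        rw [mul_comm]
        refine iSup_mul_le fun hs => ?_
        subst hs
        rw [one_mul]
        refine iSup_le fun w => ?_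
        obtain ⟨w, rfl, rfl⟩ := w
        have h := Θ.ξ_map_iSup (fun y : Θ.T (Θ.T X) => (y, Θ.m y)) (fun _ => (1 : V)) w
        refine le_trans (Θ.ξ_map_mono _ _ (fun p => ?_) w) (h.le.trans ?_)
        · refine iSup_le fun hp => ?_
          exact le_iSup (fun _ : {y : Θ.T (Θ.T X) // (y, Θ.m y) = p} => (1 : V))
            ⟨p.1, Prod.ext rfl hp⟩
        · refine iSup_le fun s => ?_
          obtain ⟨s, rfl⟩ := s
          dsimp only
          rw [ξ_const]
          refine le_iSup (fun _ : _ = _ => (1 : V)) ?_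
          simp only [map_map]
          rw [map_id]
          exact (Θ.m_map_m s).symm }

/-- The quantale `V` as a `T`-category, with structure `(t, v) ↦ ξ t ⊸ v`. -/
abbrev quantale (Θ : StrictTopologicalTheory V) : TCat Θ where
  carrier := V
  str t v := Quantale.leftMulResiduation (Θ.ξ t) v
  isTCategory :=
    { refl := fun v => by
        rw [hom_iff, one_mul]; exact (Θ.ξ_e v).le
      trans := fun t s v => by
        rw [hom_iff, mul_assoc, mul_comm]
        rw [mul_assoc]
        refine le_trans (mul_le_mul_V le_rfl ?_) (hom_iff.1 le_rfl : _ * Θ.ξ s ≤ v)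
        rw [mul_comm]
        refine iSup_mul_le fun w => ?_
        obtain ⟨w, rfl, rfl⟩ := w
        dsimp only
        rw [← Θ.ξ_map_ξ]
        simp only [map_map]
        rw [ξ_mul_map]
        exact Θ.ξ_map_mono _ _ (fun p => hom_iff.1 le_rfl) w }

/-- The `V`-category `M(X) = (TX, Tξ a · m_X°)`. -/
def mStr (X : TCat Θ) : Θ.T X.carrier → Θ.T X.carrier → V := fun x y =>
  ⨆ t : {t : Θ.T (Θ.T X.carrier) // Θ.m t = x}, Θ.Tξ X.str t y

theorem mStr_refl (X : TCat Θ) (x : Θ.T X.carrier) : 1 ≤ X.mStr x x := by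
  refine le_trans ?_ (le_iSup (fun t : {t : Θ.T (Θ.T X.carrier) // Θ.m t = x} => Θ.Tξ X.str t x)
    ⟨Θ.map Θ.e x, Θ.m_map_e x⟩)
  have h := Θ.one_le_Tξ X.str Θ.e (fun x => x) X.isTCategory.refl x
  rwa [map_id] at h

theorem mStr_mul_str_le (X : TCat Θ) (x y : Θ.T X.carrier) (z : X.carrier) :
    X.mStr x y * X.str y z ≤ X.str x z := by
  refine iSup_mul_le fun t => ?_
  obtain ⟨t, rfl⟩ := t
  exact X.isTCategory.trans t y z

theorem mStr_trans (X : TCat Θ) (x y z : Θ.T X.carrier) :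
    X.mStr x y * X.mStr y z ≤ X.mStr x z := by
  refine iSup_mul_le fun t => mul_iSup_le fun s => ?_
  obtain ⟨t, rfl⟩ := t
  obtain ⟨s, rfl⟩ := s
  refine le_trans (mul_le_mul_V (Θ.Tξ_m_le X.str t s) le_rfl) ?_
  refine iSup_mul_le fun q => ?_
  obtain ⟨q, rfl⟩ := q
  refine le_trans (Θ.Tξ_mul_le (q := fun a b => X.str (Θ.m a) b)
    (fun a b c => X.isTCategory.trans a b c)) ?_
  refine le_trans (Θ.Tξ_comap_le X.str Θ.m (fun b => b) q z) ?_
  rw [map_id]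
  exact le_iSup (fun t : {t : Θ.T (Θ.T X.carrier) // Θ.m t = Θ.m (Θ.m q)} => Θ.Tξ X.str t z)
    ⟨Θ.map Θ.m q, Θ.m_map_m q⟩

/-- The `T`-category `(X, e_X° · Tξ r)` associated with a `V`-category `(X, r)`. -/
abbrev ofVCat (Θ : StrictTopologicalTheory V) {X : Type u} (r : X → X → V)
    (h₁ : ∀ x, 1 ≤ r x x) (h₂ : ∀ x y z, r x y * r y z ≤ r x z) : TCat Θ where
  carrier := X
  str t x := Θ.Tξ r t (Θ.e x)
  isTCategory :=
    { refl := fun x => by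
        have h := Θ.one_le_Tξ r (fun x => x) (fun x => x) h₁ (Θ.e x)
        rwa [map_id] at h
      trans := fun t s x => by
        have h := Θ.Tξ_comap_le (Θ.Tξ r) (fun b => b) Θ.e t s
        rw [map_id] at h
        refine le_trans (mul_le_mul_V (h.trans (Θ.Tξ_Tξ_le r _ _)) le_rfl) ?_
        rw [show Θ.m (Θ.map Θ.e s) = s from Θ.m_map_e s]
        exact Θ.Tξ_mul_le h₂ }

/-- The dual `T`-category `X^op`, obtained from the dual of the `V`-category `M(X)`. -/
abbrev op (X : TCat Θ) : TCat Θ :=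
  ofVCat Θ (fun x y => X.mStr y x) X.mStr_refl
    (fun x y z => by rw [mul_comm]; exact X.mStr_trans z y x)

/-- The exponential `X ⊸ Y`, for a `T`-category `X = (X, a)` with `a · Tξ a = a · m_X`: the set of
`T`-functors from `X` to `Y`, with structure
`(p, h) ↦ ⨅ (q, x), a (Tπ₁ q) x ⊸ b (T ev q) (h x)`, where `Tπ₂ q = p`. -/
abbrev exp (X Y : TCat Θ)
    (hX : ∀ t x, ⨆ s : Θ.T X.carrier, Θ.Tξ X.str t s * X.str s x = X.str (Θ.m t) x) : TCat Θ where
  carrier := X ⟶ Y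
  str p h := ⨅ q : {q : Θ.T (X.carrier × (X ⟶ Y)) // Θ.map Prod.snd q = p}, ⨅ x : X.carrier,
    Quantale.leftMulResiduation (X.str (Θ.map Prod.fst q.1) x)
      (Y.str (Θ.map (fun z : X.carrier × (X ⟶ Y) => z.2.toFun z.1) q.1) (h.toFun x))
  isTCategory := by
    set c : Θ.T (X ⟶ Y) → (X ⟶ Y) → V := fun p h =>
      ⨅ q : {q : Θ.T (X.carrier × (X ⟶ Y)) // Θ.map Prod.snd q = p}, ⨅ x : X.carrier,
        Quantale.leftMulResiduation (X.str (Θ.map Prod.fst q.1) x)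
          (Y.str (Θ.map (fun z : X.carrier × (X ⟶ Y) => z.2.toFun z.1) q.1) (h.toFun x)) with hc
    have key : ∀ (q : Θ.T (X.carrier × (X ⟶ Y))) (x : X.carrier) (h : X ⟶ Y),
        c (Θ.map Prod.snd q) h * X.str (Θ.map Prod.fst q) x ≤
          Y.str (Θ.map (fun z : X.carrier × (X ⟶ Y) => z.2.toFun z.1) q) (h.toFun x) := by
      intro q x h
      rw [← hom_iff]
      exact (iInf_le _ (⟨q, rfl⟩ : {q' : Θ.T (X.carrier × (X ⟶ Y)) //
        Θ.map Prod.snd q' = Θ.map Prod.snd q})).trans (iInf_le _ x)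
    refine ⟨fun h => ?_, fun t s h => ?_⟩
    · refine le_iInf fun q => le_iInf fun x => ?_
      obtain ⟨q, hq⟩ := q
      rw [hom_iff, one_mul]
      have hq' : Θ.map Prod.snd q = Θ.map (fun _ : PUnit.{u + 1} => h) (Θ.e PUnit.unit) := by
        rw [hq, map_e]
      obtain ⟨w, hw, -⟩ := Θ.exists_lift _ _ q _ hq'
      subst hw
      simp only [map_map]
      have h1 : (fun z : {p : (X.carrier × (X ⟶ Y)) × PUnit.{u + 1} // p.1.2 = h} =>
          z.1.1.2.toFun z.1.1.1) = fun z => h.toFun z.1.1.1 := by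
        funext z; rw [z.2]
      rw [h1]
      have h2 := h.isTFunctor (Θ.map (fun z : {p : (X.carrier × (X ⟶ Y)) × PUnit.{u + 1} //
        p.1.2 = h} => z.1.1.1) w) x
      simp only [map_map] at h2
      exact h2
    · refine le_iInf fun q => le_iInf fun x => ?_
      obtain ⟨q, hq⟩ := q
      rw [hom_iff]
      obtain ⟨Q, rfl, rfl⟩ := Θ.exists_m_lift (Prod.snd : X.carrier × (X ⟶ Y) → _) q t hq
      dsimp only
      have hm1 : Θ.map Prod.fst (Θ.m Q) = Θ.m (Θ.map (Θ.map Prod.fst) Q) :=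
        (Θ.m_map_map _ Q).symm
      have hm2 : Θ.map (fun z : X.carrier × (X ⟶ Y) => z.2.toFun z.1) (Θ.m Q) =
          Θ.m (Θ.map (Θ.map (fun z : X.carrier × (X ⟶ Y) => z.2.toFun z.1)) Q) :=
        (Θ.m_map_map _ Q).symm
      rw [hm1, hm2, ← hX]
      refine mul_iSup_le fun y => ?_
      rw [mul_mul_mul_comm]
      rw [show Θ.Tξ c (Θ.map (Θ.map Prod.snd) Q) s =
        Θ.Tξ c (Θ.map (Θ.map Prod.snd) Q) s from rfl]
      have main : ∀ w₁ : Θ.T (Θ.T (X ⟶ Y) × (X ⟶ Y)),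
          Θ.map Prod.fst w₁ = Θ.map (Θ.map Prod.snd) Q → Θ.map Prod.snd w₁ = s →
          ∀ w₂ : Θ.T (Θ.T X.carrier × X.carrier),
          Θ.map Prod.fst w₂ = Θ.map (Θ.map Prod.fst) Q → Θ.map Prod.snd w₂ = y →
          Θ.ξ (Θ.map (fun p => c p.1 p.2) w₁) * Θ.ξ (Θ.map (fun p => X.str p.1 p.2) w₂) *
            (c s h * X.str y x) ≤
          Y.str (Θ.m (Θ.map (Θ.map (fun z : X.carrier × (X ⟶ Y) => z.2.toFun z.1)) Q))
            (h.toFun x) := by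
        intro w₁ h11 h12 w₂ h21 h22
        obtain ⟨u₁, hu1, hu2⟩ := Θ.exists_lift _ _ Q w₁ h11.symm
        have h3 : Θ.map (fun p : {p : Θ.T (X.carrier × (X ⟶ Y)) × (Θ.T (X ⟶ Y) × (X ⟶ Y)) //
            Θ.map Prod.snd p.1 = p.2.1} => Θ.map Prod.fst p.1.1) u₁ = Θ.map Prod.fst w₂ := by
          rw [h21, ← hu1, map_map]
        obtain ⟨v, hv1, hv2⟩ := Θ.exists_lift _ _ u₁ w₂ h3
        subst hv1 hv2 hu1 hu2 h12 h22
        simp only [map_map, ξ_mul_map]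
        refine le_trans (mul_le_mul_V (q := Θ.Tξ Y.str
          (Θ.map (fun p => Θ.map (fun z : X.carrier × (X ⟶ Y) => z.2.toFun z.1) p.1.1.1.1) v)
          (Θ.map (fun p => p.1.1.1.2.2.toFun p.1.2.2) v))
          (s := Y.str (Θ.map (fun p => p.1.1.1.2.2.toFun p.1.2.2) v) (h.toFun x)) ?_ ?_)
          (Y.isTCategory.trans _ _ _)
        · refine le_trans (Θ.ξ_map_mono _ _ (fun p => ?_) v) (Θ.le_Tξ Y.str _ _ v)
          have h4 := key p.1.1.1.1 p.1.2.2 p.1.1.1.2.2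
          have h5 : Θ.map Prod.fst p.1.1.1.1 = p.1.2.1 := p.2
          have h6 : Θ.map Prod.snd p.1.1.1.1 = p.1.1.1.2.1 := p.1.1.2
          rw [h5, h6] at h4
          exact h4
        · have h4 := key (Θ.map (fun p => (p.1.2.2, p.1.1.1.2.2)) v) x h
          simp only [map_map] at h4
          exact h4
      rw [mul_assoc]
      refine iSup_mul_le fun w₁ => ?_
      rw [← mul_assoc, mul_comm _ (Θ.Tξ X.str _ _), mul_assoc]
      refine iSup_mul_le fun w₂ => ?_
      rw [← mul_assoc, mul_comm (Θ.ξ _) (Θ.ξ _)]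
      exact main w₁.1 w₁.2.1 w₁.2.2 w₂.1 w₂.2.1 w₂.2.2

theorem free_str_comp (X : Type u) (t : Θ.T (Θ.T (Θ.T X))) (x : Θ.T X) :
    ⨆ s : Θ.T (Θ.T X), Θ.Tξ (free Θ X).str t s * (free Θ X).str s x = (free Θ X).str (Θ.m t) x := by
  refine le_antisymm (iSup_le fun s => (free Θ X).isTCategory.trans t s x) ?_
  refine iSup_le fun h => ?_
  refine le_trans ?_ (le_iSup _ (Θ.map Θ.m t))
  have h1 := Θ.one_le_Tξ (free Θ X).str (fun s => s) Θ.m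
    (fun w => le_iSup (fun _ : Θ.m w = Θ.m w => (1 : V)) rfl) t
  rw [map_id] at h1
  have h2 : (1 : V) ≤ (free Θ X).str (Θ.map Θ.m t) x :=
    le_iSup (fun _ : Θ.m (Θ.map Θ.m t) = x => (1 : V)) ((Θ.m_map_m t).trans h)
  calc (1 : V) = 1 * 1 := (one_mul 1).symm
    _ ≤ _ := mul_le_mul_V h1 h2

/-- The exponential `|X| ⊸ V`. -/
abbrev freeExp (Θ : StrictTopologicalTheory V) (X : Type u) : TCat Θ :=
  exp (free Θ X) (quantale Θ) (free_str_comp X)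

/-- The presheaf `T`-category `X̂`: the `T`-functors `ψ : |X| → V` that are also `T`-functors
`X^op → V`, as a subcategory of `|X| ⊸ V`. -/
abbrev hat (X : TCat Θ) : TCat Θ :=
  (freeExp Θ X.carrier).sub
    {ψ : free Θ X.carrier ⟶ quantale Θ | Θ.IsTFunctor X.op.str (quantale Θ).str ψ.toFun}

theorem str_free_functor (X : TCat Θ) (x : X.carrier) :
    Θ.IsTFunctor (free Θ X.carrier).str (quantale Θ).str (fun t => X.str t x) := by
  refine fun t s => iSup_le fun h => ?_
  subst h
  refine hom_iff.2 ?_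
  rw [one_mul]
  have h1 := Θ.le_Tξ X.str (fun s => s) (fun _ => x) t
  rw [map_id, map_const] at h1
  refine h1.trans ?_
  refine le_trans ?_ (X.isTCategory.trans t (Θ.e x) x)
  conv_lhs => rw [← mul_one (Θ.Tξ X.str t (Θ.e x))]
  exact mul_le_mul_V le_rfl (X.isTCategory.refl x)

theorem str_op_functor (X : TCat Θ) (x : X.carrier) :
    Θ.IsTFunctor X.op.str (quantale Θ).str (fun t => X.str t x) := by
  refine fun t s => hom_iff.2 (iSup_mul_le fun w => ?_)
  obtain ⟨w, rfl, hw⟩ := w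
  rw [map_map, ξ_mul_map]
  refine le_trans (Θ.ξ_map_mono _ (fun p => X.str p.2 x)
    (fun p => X.mStr_mul_str_le p.2 p.1 x) w) ?_
  have h1 : Θ.ξ (Θ.map (fun t => X.str t x) (Θ.map Prod.snd w)) = X.str s x := by
    rw [hw, map_e]; exact Θ.ξ_e _
  rw [map_map] at h1
  exact h1.le

/-- The Yoneda functor `X → X̂`, `x ↦ a(-, x)`. -/
def yoneda (X : TCat Θ) : X ⟶ X.hat where
  toFun x := ⟨⟨fun t => X.str t x, X.str_free_functor x⟩, X.str_op_functor x⟩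
  isTFunctor t x := by
    refine le_iInf fun q => le_iInf fun y => ?_
    obtain ⟨q, hq⟩ := q
    rw [map_map] at hq
    rw [hom_iff]
    obtain ⟨w, rfl, rfl⟩ := Θ.exists_lift _ _ q t hq
    refine mul_iSup_le fun hy => ?_
    subst hy
    rw [mul_one]
    refine hom_iff.2 ?_
    simp only [map_map]
    have h1 : (fun z : {p : (Θ.T X.carrier × (free Θ X.carrier ⟶ quantale Θ)) × X.carrier //
        p.1.2 = (⟨fun t => X.str t p.2, X.str_free_functor p.2⟩ :
          Hom (free Θ X.carrier) (quantale Θ))} => z.1.1.2.toFun z.1.1.1) =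
        fun z => X.str z.1.1.1 z.1.2 := by
      funext z; rw [z.2]
    refine le_trans ?_ (X.isTCategory.trans (Θ.map (fun z => z.1.1.1) w)
      (Θ.map (fun z => z.1.2) w) x)
    rw [mul_comm]
    refine mul_le_mul_V ?_ le_rfl
    refine le_trans (le_of_eq ?_) (Θ.le_Tξ X.str _ _ w)
    exact congrArg (fun k => Θ.ξ (Θ.map k w)) h1

/-- `X̃`, the L-closure of `y(X)` in `X̂`. -/
abbrev tilde (X : TCat Θ) : TCat Θ := X.hat.sub (X.hat.lClosure (Set.range X.yoneda.toFun))

theorem yoneda_mem (X : TCat Θ) (x : X.carrier) :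
    X.yoneda.toFun x ∈ X.hat.lClosure (Set.range X.yoneda.toFun) := by
  intro Y f g h
  have h1 := h _ ⟨x, rfl⟩
  constructor <;> intro t _ <;> simp only [upperStar] <;> rw [h1]

/-- The Yoneda functor, with codomain restricted to `X̃`. -/
def yonedaTilde (X : TCat Θ) : X ⟶ X.tilde where
  toFun x := ⟨X.yoneda.toFun x, X.yoneda_mem x⟩
  isTFunctor t x := by
    have h := X.yoneda.isTFunctor t x
    change _ ≤ X.hat.str (Θ.map Subtype.val (Θ.map _ t)) (X.yoneda.toFun x)
    rw [map_map]
    exact h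

end TCat

/-- The full subcategory of L-separated `T`-categories. -/
abbrev CatSep (Θ : StrictTopologicalTheory V) : Type (u + 1) :=
  ObjectProperty.FullSubcategory (C := TCat Θ) TCat.LSeparated

/-- L-completeness, as a property of L-separated `T`-categories. -/
def lCompleteProperty (Θ : StrictTopologicalTheory V) : ObjectProperty (CatSep Θ) :=
  fun X => X.obj.LComplete

/-- The full subcategory of `CatSep Θ` of L-complete `T`-categories. -/
abbrev CatCompl (Θ : StrictTopologicalTheory V) : Type (u + 1) :=
  (lCompleteProperty Θ).FullSubcategory

/-- The full inclusion functor of the L-complete objects. -/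
abbrev complInclusion (Θ : StrictTopologicalTheory V) : CatCompl Θ ⥤ CatSep Θ :=
  (lCompleteProperty Θ).ι

/-- A morphism `j : X ⟶ Y` into an L-complete L-separated `T`-category is a reflection map if every
morphism from `X` into such a `T`-category factors uniquely through `j`. -/
def IsReflectionMap {X : CatSep Θ} {Y : CatCompl Θ} (j : X ⟶ (complInclusion Θ).obj Y) : Prop :=
  ∀ (Z : CatCompl Θ) (f : X ⟶ (complInclusion Θ).obj Z),
    ∃! g : Y ⟶ Z, j ≫ (complInclusion Θ).map g = f

end

end StrictTopologicalTheory

/-!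
For a map `f : X → Y` into a `T`-category `(Y, b)`, a point `x` of `Y` lies in the L-closure of
`f(X)` exactly if `k ≤ (f_* ∘ f^*)(e x, x)`. That the inequality suffices is a short computation
(`mem_lClosure_range`). For the converse, `f_* ∘ f^*` is a module `Y ⇸ Y` which agrees with the
identity module `b` on `f(X)`; a module `φ : X ⇸ Y` is the same thing as a `T`-functor
`y ↦ φ(-, y)` from `Y` to `X̂` (`IsTModule.curry`), so `b` and `f_* ∘ f^*` give two functors
`Y → Ŷ` which coincide on `f(X)` and hence are equivalent at `x`; the Yoneda lemma
(`hat_str_map_yoneda`) turns this into `b(-, x) ≤ (f_* ∘ f^*)(-, x)`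
(`str_le_kleisli_of_mem_lClosure`). In particular `X` is L-dense in `X̃`.

For L-completeness of `X̃`, restrict an adjunction `φ ⊣ ψ` of modules between `Z` and `X̃` along
the Yoneda functor `y : X → X̃`. The module `ψ ∘ y_* : X ⇸ Z` corresponds to a `T`-functor
`g : Z → X̂`; the inequality `φ(-, y x) ≤ X̂(g -, y x)`, a consequence of the counit, and the unit
show that `g` takes values in `X̃`. By density of `y`, `g^* = ψ`, and `g_* = φ` because left
adjoints are unique.

If `j : X → Y` is fully faithful and L-dense, then `j_*` and `j^*` are mutually inverse modules, so
a functor `f : X → Z` yields the adjunction `f_* ∘ j^* ⊣ j_* ∘ f^*`, which is represented by a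
functor `Y → Z` when `Z` is L-complete; this is the extension of `f` along `j`. The reflection is
`X ↦ X̃`, and its unit is an epimorphism as functors which agree along an L-dense functor are
equivalent. All module calculus rests on the associativity of the Kleisli convolution
(`kleisli_assoc`).
-/

namespace StrictTopologicalTheory

variable {V : Type u} [CompleteLattice V] [CommMonoid V] [IsQuantale V]

section

variable (Θ : StrictTopologicalTheory V) {W X Y Z : Type u}

/-! ### Extension of relations and Kleisli convolution -/

theorem Tξ_mono {r s : X → Y → V} (h : ∀ x y, r x y ≤ s x y) (x : Θ.T X) (y : Θ.T Y) :
    Θ.Tξ r x y ≤ Θ.Tξ s x y :=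
  iSup_mono fun w => Θ.ξ_map_mono _ _ (fun p => h p.1 p.2) w.1

theorem Tξ_map_left (r : X → Y → V) (f : W → X) (w : Θ.T W) (y : Θ.T Y) :
    Θ.Tξ r (Θ.map f w) y = Θ.Tξ (fun a b => r (f a) b) w y := by
  refine le_antisymm (iSup_le ?_) ?_
  · rintro ⟨t, ht, rfl⟩
    obtain ⟨v, rfl, rfl⟩ := Θ.exists_lift Prod.fst f t w ht
    dsimp only
    refine le_trans (le_of_eq ?_) ((Θ.le_Tξ (fun a b => r (f a) b) (fun p => p.1.2)
      (fun p => p.1.1.2) v).trans_eq ?_)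
    · rw [map_map]
      congr 2
      funext p
      rw [← p.2]
    · rw [map_map]
  · have h := Θ.Tξ_comap_le r f (fun b => b) w y
    rwa [map_id] at h

theorem le_Tξ_e (r : X → Y → V) (x : X) (y : Y) : r x y ≤ Θ.Tξ r (Θ.e x) (Θ.e y) := by
  have h := Θ.le_Tξ r (fun _ => x) (fun _ => y) (Θ.e PUnit.unit)
  rwa [map_e, map_e, map_e, show Θ.ξ (Θ.e (r x y)) = r x y from Θ.ξ_e _] at h

theorem le_kleisli (b : Θ.T Y → Z → V) (a : Θ.T X → Y → V) (t : Θ.T (Θ.T X)) (y : Θ.T Y)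
    (z : Z) : Θ.Tξ a t y * b y z ≤ Θ.kleisli b a (Θ.m t) z :=
  le_iSup_of_le (⟨t, rfl⟩ : {s : Θ.T (Θ.T X) // Θ.m s = Θ.m t}) (le_iSup_of_le y le_rfl)

theorem kleisli_le {b : Θ.T Y → Z → V} {a : Θ.T X → Y → V} {c : Θ.T X → Z → V}
    (h : ∀ t y z, Θ.Tξ a t y * b y z ≤ c (Θ.m t) z) (x : Θ.T X) (z : Z) :
    Θ.kleisli b a x z ≤ c x z := by
  refine iSup_le ?_
  rintro ⟨t, rfl⟩
  exact iSup_le fun y => h t y z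

theorem kleisli_mono {b b' : Θ.T Y → Z → V} {a a' : Θ.T X → Y → V}
    (hb : ∀ y z, b y z ≤ b' y z) (ha : ∀ x y, a x y ≤ a' x y) (x : Θ.T X) (z : Z) :
    Θ.kleisli b a x z ≤ Θ.kleisli b' a' x z :=
  Θ.kleisli_le (fun t y z =>
    (mul_le_mul_V (Θ.Tξ_mono ha t y) (hb y z)).trans (Θ.le_kleisli b' a' t y z)) x z

/-- Half of the functoriality `Tξ (b · Tξ a · m°) = Tξ b · Tξ (Tξ a) · (T m)°`. -/
theorem Tξ_kleisli_mul_le {b : Θ.T Y → Z → V} {a : Θ.T X → Y → V} {t : Θ.T (Θ.T X)} {z : Θ.T Z}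
    {q r : V} (h : ∀ (t' : Θ.T (Θ.T (Θ.T X))) (y : Θ.T (Θ.T Y)), Θ.map Θ.m t' = t →
      Θ.Tξ (Θ.Tξ a) t' y * Θ.Tξ b y z * q ≤ r) :
    Θ.Tξ (Θ.kleisli b a) t z * q ≤ r := by
  refine iSup_mul_le ?_
  rintro ⟨w, rfl, rfl⟩
  dsimp only
  -- a join over pairs `(t, y)` with `m t = x` is a join over a fibre, which `ξ` preserves
  have h1 := Θ.ξ_map_iSup (fun p : Θ.T (Θ.T X) × Θ.T Y × Z => (Θ.m p.1, p.2.2))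
    (fun p => Θ.Tξ a p.1 p.2.1 * b p.2.1 p.2.2) w
  refine le_trans (mul_le_mul_V ((Θ.ξ_map_mono _ _ (fun p => ?_) w).trans h1.le) le_rfl) ?_
  · refine iSup_le fun t => iSup_le fun y => ?_
    exact le_iSup_of_le (⟨(t.1, y, p.2), Prod.ext t.2 rfl⟩ :
      {s : Θ.T (Θ.T X) × Θ.T Y × Z // (Θ.m s.1, s.2.2) = p}) le_rfl
  · refine iSup_mul_le ?_
    rintro ⟨s, rfl⟩
    refine le_trans (mul_le_mul_V ?_ le_rfl)
      (h (Θ.map (fun p => p.1) s) (Θ.map (fun p => p.2.1) s) (by simp only [map_map]))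
    dsimp only
    rw [← ξ_mul_map, map_map]
    exact mul_le_mul_V (Θ.le_Tξ (Θ.Tξ a) _ _ s) (Θ.le_Tξ b _ _ s)

theorem Tξ_mul_le_Tξ_kleisli (b : Θ.T Y → Z → V) (a : Θ.T X → Y → V)
    (t : Θ.T (Θ.T (Θ.T X))) (y : Θ.T (Θ.T Y)) (z : Θ.T Z) :
    Θ.Tξ (Θ.Tξ a) t y * Θ.Tξ b y z ≤ Θ.Tξ (Θ.kleisli b a) (Θ.map Θ.m t) z := by
  rw [Tξ_map_left]
  exact Θ.Tξ_mul_le fun t y z => Θ.le_kleisli b a t y z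

theorem kleisli_assoc (c : Θ.T Z → W → V) (b : Θ.T Y → Z → V) (a : Θ.T X → Y → V) :
    Θ.kleisli c (Θ.kleisli b a) = Θ.kleisli (Θ.kleisli c b) a := by
  funext x w
  refine le_antisymm (Θ.kleisli_le (fun t z w => ?_) x w) (Θ.kleisli_le (fun t y w => ?_) x w)
  · refine Θ.Tξ_kleisli_mul_le fun t' y ht => ?_
    subst ht
    rw [mul_assoc, m_map_m]
    exact (mul_le_mul_V (Θ.Tξ_Tξ_le a t' y) (Θ.le_kleisli c b y z w)).trans
      (Θ.le_kleisli (Θ.kleisli c b) a (Θ.m t') (Θ.m y) w)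
  · refine mul_iSup_le ?_
    rintro ⟨s, rfl⟩
    refine mul_iSup_le fun z => ?_
    refine (mul_le_mul_V (Θ.Tξ_m_le a t s) le_rfl).trans (iSup_mul_le ?_)
    rintro ⟨t', rfl⟩
    rw [← mul_assoc, ← m_map_m]
    exact (mul_le_mul_V (Θ.Tξ_mul_le_Tξ_kleisli b a t' s z) le_rfl).trans
      (Θ.le_kleisli c (Θ.kleisli b a) (Θ.map Θ.m t') z w)

end

namespace TCat

variable {Θ : StrictTopologicalTheory V}

/-! ### The calculus of modules -/

theorem kleisli_str_str (X : TCat Θ) (t : Θ.T X.carrier) (x : X.carrier) :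
    Θ.kleisli X.str X.str t x ≤ X.str t x :=
  Θ.kleisli_le X.isTCategory.trans t x

theorem isTModule_str (X : TCat Θ) : IsTModule X X X.str :=
  ⟨X.kleisli_str_str, X.kleisli_str_str⟩

namespace IsTModule

variable {X Y Z : TCat Θ} {φ : Θ.T X.carrier → Y.carrier → V} {ψ : Θ.T Y.carrier → Z.carrier → V}

theorem Tξ_mul_str_le (h : IsTModule X Y φ) (t : Θ.T (Θ.T X.carrier)) (s : Θ.T Y.carrier)
    (y : Y.carrier) : Θ.Tξ φ t s * Y.str s y ≤ φ (Θ.m t) y :=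
  (Θ.le_kleisli _ _ t s y).trans (h.2 _ _)

theorem Tξ_str_mul_le (h : IsTModule X Y φ) (t : Θ.T (Θ.T X.carrier)) (s : Θ.T X.carrier)
    (y : Y.carrier) : Θ.Tξ X.str t s * φ s y ≤ φ (Θ.m t) y :=
  (Θ.le_kleisli _ _ t s y).trans (h.1 _ _)

theorem mStr_mul_le (h : IsTModule X Y φ) (t s : Θ.T X.carrier) (y : Y.carrier) :
    X.mStr t s * φ s y ≤ φ t y := by
  refine iSup_mul_le ?_
  rintro ⟨t, rfl⟩
  exact h.Tξ_str_mul_le t s y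

theorem str_kleisli (h : IsTModule X Y φ) : Θ.kleisli Y.str φ = φ := by
  funext t y
  refine le_antisymm (h.2 t y) ?_
  have h1 := Θ.le_kleisli Y.str φ (Θ.e t) (Θ.e y) y
  rw [m_e] at h1
  refine le_trans ?_ h1
  conv_lhs => rw [← mul_one (φ t y)]
  exact mul_le_mul_V (Θ.le_Tξ_e φ t y) (Y.isTCategory.refl y)

/-- For a module `ψ`, the convolution `ψ ∘ f_*` is the restriction of `ψ` along `f`. -/
theorem kleisli_lowerStar (h : IsTModule Y Z ψ) (f : X ⟶ Y) :
    Θ.kleisli ψ (Y.lowerStar f.toFun) = fun t z => ψ (Θ.map f.toFun t) z := by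
  funext t z
  refine le_antisymm (Θ.kleisli_le (c := fun t z => ψ (Θ.map f.toFun t) z)
    (fun t s z => ?_) t z) ?_
  · rw [← m_map_map]
    refine le_trans (mul_le_mul_V ?_ le_rfl) (h.Tξ_str_mul_le _ s z)
    rw [Tξ_map_left]
    exact le_rfl
  · have h1 := Θ.le_kleisli ψ (Y.lowerStar f.toFun) (Θ.map Θ.e t) (Θ.map f.toFun t) z
    rw [m_map_e] at h1
    refine le_trans ?_ h1
    conv_lhs => rw [← one_mul (ψ _ z)]
    refine mul_le_mul_V (Θ.one_le_Tξ _ Θ.e f.toFun (fun x => ?_) t) le_rfl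
    change 1 ≤ Y.str (Θ.map f.toFun (Θ.e x)) (f.toFun x)
    rw [map_e]
    exact Y.isTCategory.refl _

theorem kleisli_str (h : IsTModule X Y φ) : Θ.kleisli φ X.str = φ := by
  have h1 := h.kleisli_lowerStar (𝟙 X)
  have h2 : X.lowerStar (𝟙 X : X ⟶ X).toFun = X.str := by
    funext t x
    exact congrArg (fun s => X.str s x) (Θ.map_id t)
  rw [h2] at h1
  rw [h1]
  funext t y
  exact congrArg (fun s => φ s y) (Θ.map_id t)

/-- For a module `φ`, the convolution `f^* ∘ φ` is the restriction of `φ` along `f`. -/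
theorem upperStar_kleisli {W : Type u} (h : IsTModule X Y φ) (f : W → Y.carrier) :
    Θ.kleisli (Y.upperStar f) φ = fun t x => φ t (f x) := by
  funext t x
  exact congrFun (congrFun h.str_kleisli t) (f x)

theorem kleisli (h : IsTModule X Y φ) (h' : IsTModule Y Z ψ) : IsTModule X Z (Θ.kleisli ψ φ) := by
  constructor
  · intro t z
    rw [← kleisli_assoc, h.kleisli_str]
  · intro t z
    rw [kleisli_assoc, h'.str_kleisli]

end IsTModule

theorem isTModule_lowerStar {X Y : TCat Θ} (f : X ⟶ Y) :
    IsTModule X Y (Y.lowerStar f.toFun) := by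
  constructor
  · refine Θ.kleisli_le fun t s y => ?_
    change _ * Y.str (Θ.map f.toFun s) y ≤ Y.str (Θ.map f.toFun (Θ.m t)) y
    rw [← m_map_map]
    refine le_trans (mul_le_mul_V ?_ le_rfl) (Y.isTCategory.trans _ (Θ.map f.toFun s) y)
    exact (Θ.Tξ_mono f.isTFunctor t s).trans (Θ.Tξ_comap_le Y.str (Θ.map f.toFun) f.toFun t s)
  · intro t y
    rw [Y.isTModule_str.kleisli_lowerStar f]
    exact le_rfl

theorem isTModule_upperStar {X Y : TCat Θ} (f : X ⟶ Y) :
    IsTModule Y X (Y.upperStar f.toFun) := by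
  constructor
  · exact fun t x => Y.kleisli_str_str t (f.toFun x)
  · refine Θ.kleisli_le fun t s x => ?_
    refine le_trans (mul_le_mul_V ?_ (f.isTFunctor s x)) (Y.isTCategory.trans t _ _)
    have h := Θ.Tξ_comap_le Y.str (fun a => a) f.toFun t s
    rwa [map_id] at h

theorem kleisli_lowerStar_upperStar_le {X Y : TCat Θ} (f : X ⟶ Y) (t : Θ.T Y.carrier)
    (y : Y.carrier) : Θ.kleisli (Y.lowerStar f.toFun) (Y.upperStar f.toFun) t y ≤ Y.str t y := by
  refine Θ.kleisli_le (fun t s y => ?_) t y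
  refine le_trans (mul_le_mul_V ?_ le_rfl) (Y.isTCategory.trans t (Θ.map f.toFun s) y)
  have h := Θ.Tξ_comap_le Y.str (fun a => a) f.toFun t s
  rwa [map_id] at h

theorem FullyFaithful.kleisli_upperStar_lowerStar {X Y : TCat Θ} {f : X ⟶ Y}
    (hf : FullyFaithful f) : Θ.kleisli (Y.upperStar f.toFun) (Y.lowerStar f.toFun) = X.str := by
  rw [(isTModule_upperStar f).kleisli_lowerStar f]
  funext t x
  exact (hf t x).symm

/-- Left adjoint modules are unique. -/
theorem ModuleAdj.le_of_le {X Y : TCat Θ} {φ φ' : Θ.T X.carrier → Y.carrier → V}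
    {ψ : Θ.T Y.carrier → X.carrier → V} (h : ModuleAdj X Y φ ψ) (h' : ModuleAdj X Y φ' ψ)
    (t : Θ.T X.carrier) (y : Y.carrier) : φ t y ≤ φ' t y := by
  obtain ⟨hφ, -, -, h1⟩ := h
  obtain ⟨hφ', -, h2, -⟩ := h'
  calc φ t y = Θ.kleisli φ X.str t y := by rw [hφ.kleisli_str]
    _ ≤ Θ.kleisli φ (Θ.kleisli ψ φ') t y := Θ.kleisli_mono (fun _ _ => le_rfl) h2 t y
    _ = Θ.kleisli (Θ.kleisli φ ψ) φ' t y := by rw [kleisli_assoc]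
    _ ≤ Θ.kleisli Y.str φ' t y := Θ.kleisli_mono h1 (fun _ _ => le_rfl) t y
    _ = φ' t y := by rw [hφ'.str_kleisli]

theorem moduleAdj_star {X Y : TCat Θ} (f : X ⟶ Y) :
    ModuleAdj X Y (Y.lowerStar f.toFun) (Y.upperStar f.toFun) := by
  refine ⟨isTModule_lowerStar f, isTModule_upperStar f, fun t x => ?_,
    kleisli_lowerStar_upperStar_le f⟩
  rw [(isTModule_upperStar f).kleisli_lowerStar f]
  exact f.isTFunctor t x

/-! ### The order on functors -/

/-- The order on maps into `(Y, b)` contains the pointwise order of the relation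
`k ≤ b (e x, y)` between points. -/
theorem mapLE_of_one_le {W : Type u} (Y : TCat Θ) {f g : W → Y.carrier}
    (h : ∀ x, 1 ≤ Y.str (Θ.e (f x)) (g x)) : Y.MapLE f g := by
  intro t x
  have h1 := Y.isTCategory.trans (Θ.e t) (Θ.e (f x)) (g x)
  rw [m_e] at h1
  refine le_trans ?_ h1
  change Y.str t (f x) ≤ _
  conv_lhs => rw [← mul_one (Y.str t (f x))]
  exact mul_le_mul_V (Θ.le_Tξ_e Y.str t (f x)) (h x)

theorem lSeparated_of_str_injective (X : TCat Θ)
    (h : ∀ x y : X.carrier, (∀ t, X.str t x = X.str t y) → x = y) : X.LSeparated := by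
  intro Y f g hfg hgf
  exact Hom.ext (funext fun z => h _ _ fun t => le_antisymm (hfg t z) (hgf t z))

theorem LSeparated.eq_of_str_eq {X : TCat Θ} (hX : X.LSeparated) {x y : X.carrier}
    (h : ∀ t, X.str t x = X.str t y) : x = y := by
  -- as `T1 = 1`, every point is a `T`-functor from the singleton carrying the `V`-category
  -- structure `k`
  let E : TCat Θ := ofVCat Θ (X := PUnit.{u + 1}) (fun _ _ => 1) (fun _ => le_rfl)
    (fun _ _ _ => (mul_one 1).le)
  have hE : ∀ (z : X.carrier), Θ.IsTFunctor E.str X.str (fun _ => z) := by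
    intro z t p
    rw [map_const]
    refine le_trans (iSup_le fun w => ?_) (X.isTCategory.refl z)
    exact (Θ.ξ_const 1 w.1).le
  have h1 := hX E ⟨fun _ => x, hE x⟩ ⟨fun _ => y, hE y⟩ (fun t _ => (h t).le)
    (fun t _ => (h t).ge)
  exact congrFun (congrArg Hom.toFun h1) PUnit.unit

/-- The criterion `k ≤ (f_* ∘ f^*)(e x, x)` puts `x` in the L-closure of the image of `f`. -/
theorem mem_lClosure_range {X Y : TCat Θ} (f : X ⟶ Y) {x : Y.carrier}
    (hx : 1 ≤ Θ.kleisli (Y.lowerStar f.toFun) (Y.upperStar f.toFun) (Θ.e x) x) :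
    x ∈ Y.lClosure (Set.range f.toFun) := by
  have key : ∀ (Z : TCat Θ) (g h : Y ⟶ Z),
      (∀ y ∈ Set.range f.toFun, g.toFun y = h.toFun y) →
      1 ≤ Z.str (Θ.e (g.toFun x)) (h.toFun x) := by
    intro Z g h hgh
    have hgh' : (fun z => g.toFun (f.toFun z)) = fun z => h.toFun (f.toFun z) :=
      funext fun z => hgh _ ⟨z, rfl⟩
    rw [← map_e]
    refine hx.trans (Θ.kleisli_le (c := fun t y => Z.str (Θ.map g.toFun t) (h.toFun y))
      (fun t s y => ?_) _ _)
    rw [← m_map_map]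
    refine le_trans (mul_le_mul_V ?_ (h.isTFunctor _ y)) (Z.isTCategory.trans _ _ _)
    rw [map_map, ← hgh']
    exact (Θ.Tξ_mono (fun s z => g.isTFunctor s (f.toFun z)) t s).trans
      (Θ.Tξ_comap_le Z.str (Θ.map g.toFun) (fun z => g.toFun (f.toFun z)) t s)
  intro Z g h hgh
  exact ⟨Z.mapLE_of_one_le fun _ => key Z g h hgh,
    Z.mapLE_of_one_le fun _ => key Z h g fun y hy => (hgh y hy).symm⟩

theorem LDense.eq_of_comp_eq {X Y Z : TCat Θ} {j : X ⟶ Y} (hj : LDense j) (hZ : Z.LSeparated)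
    {g h : Y ⟶ Z} (hgh : j ≫ g = j ≫ h) : g = h := by
  have h1 : ∀ x : Y.carrier, x ∈ Y.lClosure (Set.range j.toFun) := by
    intro x
    refine mem_lClosure_range j ?_
    rw [show Θ.kleisli _ _ = Y.str from hj]
    exact Y.isTCategory.refl x
  have h2 : ∀ y ∈ Set.range j.toFun, g.toFun y = h.toFun y := by
    rintro _ ⟨x, rfl⟩
    exact congrFun (congrArg Hom.toFun hgh) x
  exact hZ Y g h (fun t x => (h1 x Z g h h2).1 t PUnit.unit)
    (fun t x => (h1 x Z g h h2).2 t PUnit.unit)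

/-! ### Presheaves and the Yoneda lemma -/

/-- The structure of `X̂` at `(Tg s, h)`, for a map `g` into `X̂`, tested on elements of
`T(TX × W)`. -/
theorem le_hat_str_map_iff {W : Type u} (X : TCat Θ) (g : W → X.hat.carrier) (s : Θ.T W)
    (h : X.hat.carrier) (c : V) :
    c ≤ X.hat.str (Θ.map g s) h ↔ ∀ w : Θ.T (Θ.T X.carrier × W), Θ.map Prod.snd w = s →
      c * Θ.ξ (Θ.map (fun z => (g z.2).1.toFun z.1) w) ≤ h.1.toFun (Θ.m (Θ.map Prod.fst w)) := by
  constructor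
  · rintro hc w rfl
    have h1 := (hc.trans (iInf_le _ ⟨Θ.map (fun z => (z.1, (g z.2).1)) w, by
      simp only [map_map]⟩)).trans (iInf_le _ (Θ.m (Θ.map Prod.fst w)))
    rw [hom_iff] at h1
    have h2 : (1 : V) ≤ (free Θ X.carrier).str (Θ.map Prod.fst
        (Θ.map (fun z => (z.1, (g z.2).1)) w)) (Θ.m (Θ.map Prod.fst w)) := by
      rw [map_map]
      exact le_iSup (fun _ : Θ.m (Θ.map Prod.fst w) = Θ.m (Θ.map Prod.fst w) => (1 : V)) rfl
    have h3 := (mul_le_mul_V le_rfl h2).trans h1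
    rw [mul_one] at h3
    have h4 := hom_iff.1 h3
    rw [map_map] at h4
    exact h4
  · intro hc
    refine le_iInf ?_
    rintro ⟨q, hq⟩
    refine le_iInf fun y => ?_
    rw [map_map] at hq
    rw [hom_iff]
    obtain ⟨w, rfl, rfl⟩ := Θ.exists_lift _ _ q s hq
    refine mul_iSup_le fun hy => ?_
    subst hy
    rw [mul_one]
    refine hom_iff.2 ?_
    have h1 := hc (Θ.map (fun p => (p.1.1.1, p.1.2)) w) (by simp only [map_map])
    simp only [map_map] at h1 ⊢
    have h2 : (fun z : {p : (Θ.T X.carrier × (free Θ X.carrier ⟶ quantale Θ)) × W //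
        p.1.2 = (g p.2).1} => z.1.1.2.toFun z.1.1.1) =
        fun z => (g z.1.2).1.toFun z.1.1.1 := by
      funext z; rw [z.2]
    exact (congrArg (fun k => c * Θ.ξ (Θ.map k w)) h2).trans_le h1

theorem mStr_mul_hat_le (X : TCat Θ) (h : X.hat.carrier) (t s : Θ.T X.carrier) :
    X.mStr t s * h.1.toFun s ≤ h.1.toFun t := by
  have h1 := (Θ.le_Tξ_e (fun x y => X.mStr y x) s t).trans (h.2 (Θ.e s) t)
  refine (hom_iff.1 h1).trans' (mul_le_mul_V le_rfl ?_)
  rw [map_e]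
  exact (Θ.ξ_e _).ge

/-- The Yoneda lemma. -/
theorem hat_str_map_yoneda (X : TCat Θ) (t : Θ.T X.carrier) (h : X.hat.carrier) :
    X.hat.str (Θ.map X.yoneda.toFun t) h = h.1.toFun t := by
  apply le_antisymm
  · have h1 := (X.le_hat_str_map_iff X.yoneda.toFun t h _).1 le_rfl
      (Θ.map (fun x => (Θ.e x, x)) t) (by rw [map_map, map_id])
    simp only [map_map] at h1
    rw [m_map_e] at h1
    refine le_trans ?_ h1
    conv_lhs => rw [← mul_one (X.hat.str _ _)]
    refine mul_le_mul_V le_rfl ?_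
    refine le_trans (Θ.ξ_const 1 t).ge (Θ.ξ_map_mono _ _ (fun x => X.isTCategory.refl x) t)
  · refine (X.le_hat_str_map_iff X.yoneda.toFun t h _).2 ?_
    rintro w rfl
    refine le_trans ?_ (X.mStr_mul_hat_le h _ (Θ.map Prod.snd w))
    rw [mul_comm]
    refine mul_le_mul_V ?_ le_rfl
    exact le_iSup_of_le (⟨Θ.map Prod.fst w, rfl⟩ :
      {t : Θ.T (Θ.T X.carrier) // Θ.m t = Θ.m (Θ.map Prod.fst w)}) (Θ.le_Tξ X.str _ _ w)

theorem hat_ext {X : TCat Θ} {g h : X.hat.carrier} (H : ∀ t, g.1.toFun t = h.1.toFun t) :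
    g = h :=
  Subtype.ext (Hom.ext (funext H))

/-- The transpose `y ↦ φ(-, y)` of a module `φ : X ⇸ Y`, as a `T`-functor `Y → X̂`. -/
def IsTModule.curry {X Y : TCat Θ} {φ : Θ.T X.carrier → Y.carrier → V} (h : IsTModule X Y φ) :
    Y ⟶ X.hat where
  toFun y := ⟨⟨fun t => φ t y, by
    refine fun t s => iSup_le fun hs => ?_
    subst hs
    refine hom_iff.2 ?_
    rw [one_mul]
    have h1 := Θ.le_Tξ φ (fun s => s) (fun _ => y) t
    rw [map_id, map_const] at h1
    refine h1.trans ((h.Tξ_mul_str_le t (Θ.e y) y).trans' ?_)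
    conv_lhs => rw [← mul_one (Θ.Tξ φ t (Θ.e y))]
    exact mul_le_mul_V le_rfl (Y.isTCategory.refl y)⟩, by
    refine fun t s => hom_iff.2 (iSup_mul_le ?_)
    rintro ⟨w, rfl, hw⟩
    rw [map_map, ξ_mul_map]
    refine le_trans (Θ.ξ_map_mono _ (fun p => φ p.2 y) (fun p => h.mStr_mul_le p.2 p.1 y) w) ?_
    have h1 : Θ.ξ (Θ.map (fun t => φ t y) (Θ.map Prod.snd w)) = φ s y := by
      rw [hw, map_e]; exact Θ.ξ_e _
    rw [map_map] at h1
    exact h1.le⟩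
  isTFunctor t y := by
    refine (X.le_hat_str_map_iff _ t _ _).2 ?_
    rintro w rfl
    refine le_trans ?_ (h.Tξ_mul_str_le (Θ.map Prod.fst w) (Θ.map Prod.snd w) y)
    rw [mul_comm]
    exact mul_le_mul_V (Θ.le_Tξ φ _ _ w) le_rfl

/-- Points of the L-closure of an image are seen by the module `f_* ∘ f^*`. -/
theorem str_le_kleisli_of_mem_lClosure {X Y : TCat Θ} (f : X ⟶ Y) {x : Y.carrier}
    (hx : x ∈ Y.lClosure (Set.range f.toFun)) (t : Θ.T Y.carrier) :
    Y.str t x ≤ Θ.kleisli (Y.lowerStar f.toFun) (Y.upperStar f.toFun) t x := by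
  have hm := (isTModule_upperStar f).kleisli (isTModule_lowerStar f)
  have h1 := hx Y.hat Y.yoneda hm.curry (by
    rintro _ ⟨z, rfl⟩
    refine hat_ext fun s => le_antisymm ?_ (kleisli_lowerStar_upperStar_le f s (f.toFun z))
    change Y.str s (f.toFun z) ≤ Θ.kleisli _ _ s (f.toFun z)
    have h2 := Θ.le_kleisli (Y.lowerStar f.toFun) (Y.upperStar f.toFun) (Θ.e s) (Θ.e z)
      (f.toFun z)
    rw [m_e] at h2
    refine h2.trans' ?_
    conv_lhs => rw [← mul_one (Y.str s (f.toFun z))]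
    refine mul_le_mul_V (Θ.le_Tξ_e (Y.upperStar f.toFun) s z) ?_
    change 1 ≤ Y.str (Θ.map f.toFun (Θ.e z)) (f.toFun z)
    rw [map_e]
    exact Y.isTCategory.refl _)
  have h2 : Y.hat.str (Θ.map Y.yoneda.toFun t) (Y.yoneda.toFun x) ≤
      Y.hat.str (Θ.map Y.yoneda.toFun t) (hm.curry.toFun x) :=
    h1.1 (Θ.map Y.yoneda.toFun t) PUnit.unit
  rw [hat_str_map_yoneda, hat_str_map_yoneda] at h2
  exact h2

/-! ### The L-closure of the Yoneda image -/

theorem tilde_str_map_yonedaTilde (X : TCat Θ) (t : Θ.T X.carrier) (h : X.tilde.carrier) :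
    X.tilde.str (Θ.map X.yonedaTilde.toFun t) h = h.1.1.toFun t := by
  change X.hat.str (Θ.map Subtype.val (Θ.map _ t)) h.1 = _
  rw [map_map]
  exact X.hat_str_map_yoneda t h.1

theorem fullyFaithful_yonedaTilde (X : TCat Θ) : FullyFaithful X.yonedaTilde :=
  fun t x => (X.tilde_str_map_yonedaTilde t (X.yonedaTilde.toFun x)).symm

theorem fullEmbedding_yonedaTilde {X : TCat Θ} (hX : X.LSeparated) :
    FullEmbedding X.yonedaTilde := by
  refine ⟨X.fullyFaithful_yonedaTilde, fun x y hxy => hX.eq_of_str_eq fun t => ?_⟩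
  rw [X.fullyFaithful_yonedaTilde t x, X.fullyFaithful_yonedaTilde t y, hxy]

theorem lDense_yonedaTilde (X : TCat Θ) : LDense X.yonedaTilde := by
  funext t h
  refine le_antisymm (kleisli_lowerStar_upperStar_le X.yonedaTilde t h) ?_
  refine (str_le_kleisli_of_mem_lClosure X.yoneda h.2 (Θ.map Subtype.val t)).trans (iSup_le ?_)
  rintro ⟨p, hp⟩
  refine iSup_le fun s => ?_
  -- the witness in `TTX̂` lies over `t`, hence comes from `TTX̃`
  obtain ⟨q, rfl, rfl⟩ := Θ.exists_m_lift Subtype.val t p hp.symm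
  refine le_trans (mul_le_mul_V ?_ ?_)
    (Θ.le_kleisli (X.tilde.lowerStar X.yonedaTilde.toFun) (X.tilde.upperStar X.yonedaTilde.toFun)
      q s h)
  · rw [Tξ_map_left]
    exact le_rfl
  · change X.hat.str (Θ.map X.yoneda.toFun s) h.1 ≤ X.tilde.str _ h
    rw [hat_str_map_yoneda, tilde_str_map_yonedaTilde]

theorem lSeparated_tilde (X : TCat Θ) : X.tilde.LSeparated := by
  refine lSeparated_of_str_injective _ fun g h H => Subtype.ext (hat_ext fun t => ?_)
  rw [← tilde_str_map_yonedaTilde, ← tilde_str_map_yonedaTilde, H]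

/-- Modules out of the codomain of an L-dense functor are determined by their restriction. -/
theorem LDense.module_ext {X Y Z : TCat Θ} {j : X ⟶ Y} (hj : LDense j)
    {φ ψ : Θ.T Y.carrier → Z.carrier → V} (hφ : IsTModule Y Z φ) (hψ : IsTModule Y Z ψ)
    (h : ∀ t z, φ (Θ.map j.toFun t) z = ψ (Θ.map j.toFun t) z) : φ = ψ := by
  have h1 : ∀ {χ : Θ.T Y.carrier → Z.carrier → V}, IsTModule Y Z χ →
      χ = Θ.kleisli (fun t z => χ (Θ.map j.toFun t) z) (Y.upperStar j.toFun) := by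
    intro χ hχ
    rw [← hχ.kleisli_lowerStar j, ← kleisli_assoc, show Θ.kleisli _ _ = Y.str from hj,
      hχ.kleisli_str]
  rw [h1 hφ, h1 hψ]
  congr 1
  funext t z
  exact h t z

theorem lComplete_tilde (X : TCat Θ) : X.tilde.LComplete := by
  intro Z φ ψ hadj
  obtain ⟨hφ, hψ, hunit, hcounit⟩ := id hadj
  -- the restrictions of the adjunction along the Yoneda functor
  have hψ' : IsTModule X Z (fun t z => ψ (Θ.map X.yonedaTilde.toFun t) z) := by
    rw [← hψ.kleisli_lowerStar X.yonedaTilde]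
    exact (isTModule_lowerStar _).kleisli hψ
  let g : Z ⟶ X.hat := hψ'.curry
  have hg' : ∀ z t, (g.toFun z).1.toFun t = ψ (Θ.map X.yonedaTilde.toFun t) z := fun _ _ => rfl
  have hφg : ∀ t x, φ t (X.yonedaTilde.toFun x) ≤
      X.hat.str (Θ.map g.toFun t) (X.yoneda.toFun x) := by
    intro t x
    refine (X.le_hat_str_map_iff g.toFun t _ _).2 ?_
    rintro w rfl
    simp only [hg']
    change _ ≤ X.str (Θ.m (Θ.map Prod.fst w)) x
    rw [X.fullyFaithful_yonedaTilde _ x, ← m_map_map]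
    refine (hcounit _ _).trans' ?_
    refine (Θ.le_kleisli φ ψ _ (Θ.map Prod.snd w) _).trans' ?_
    rw [mul_comm]
    refine mul_le_mul_V ?_ le_rfl
    rw [map_map]
    exact Θ.le_Tξ ψ (fun p => Θ.map X.yonedaTilde.toFun p.1) Prod.snd w
  -- by density, the unit of the adjunction factors through the image of `X`
  have hψφ : Θ.kleisli ψ φ = Θ.kleisli (fun t z => ψ (Θ.map X.yonedaTilde.toFun t) z)
      (fun t x => φ t (X.yonedaTilde.toFun x)) := by
    rw [← hψ.kleisli_lowerStar X.yonedaTilde, ← hφ.upperStar_kleisli X.yonedaTilde.toFun,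
      ← kleisli_assoc, kleisli_assoc (b := X.tilde.upperStar _),
      show Θ.kleisli (X.tilde.lowerStar _) _ = X.tilde.str from X.lDense_yonedaTilde,
      hφ.str_kleisli]
  have hmem : ∀ z, g.toFun z ∈ X.hat.lClosure (Set.range X.yoneda.toFun) := by
    intro z
    refine mem_lClosure_range X.yoneda ?_
    have h1 := (Z.isTCategory.refl z).trans (hunit _ _)
    rw [hψφ] at h1
    rw [← map_e]
    refine h1.trans (Θ.kleisli_le (c := fun t z => Θ.kleisli (X.hat.lowerStar X.yoneda.toFun)
      (X.hat.upperStar X.yoneda.toFun) (Θ.map g.toFun t) (g.toFun z)) (fun t s z => ?_) _ _)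
    rw [← m_map_map]
    refine (Θ.le_kleisli _ _ _ s _).trans' (mul_le_mul_V ?_ ?_)
    · rw [Tξ_map_left]
      exact Θ.Tξ_mono hφg t s
    · change _ ≤ X.hat.str (Θ.map X.yoneda.toFun s) (g.toFun z)
      rw [hat_str_map_yoneda, hg']
  let f : Z ⟶ X.tilde :=
    { toFun := fun z => ⟨g.toFun z, hmem z⟩
      isTFunctor := fun t z => by
        change _ ≤ X.hat.str (Θ.map Subtype.val (Θ.map _ t)) (g.toFun z)
        rw [map_map]
        exact g.isTFunctor t z }
  have hf : ψ = X.tilde.upperStar f.toFun := by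
    refine X.lDense_yonedaTilde.module_ext hψ (isTModule_upperStar f) fun t z => ?_
    change _ = X.tilde.str _ (f.toFun z)
    rw [tilde_str_map_yonedaTilde]
    rfl
  refine ⟨f, ?_, hf⟩
  have hadj' := moduleAdj_star f
  rw [← hf] at hadj'
  funext t x
  exact le_antisymm (hadj.le_of_le hadj' t x) (hadj'.le_of_le hadj t x)

/-! ### Extension along dense functors -/

/-- Functors into L-complete L-separated `T`-categories extend along fully faithful L-dense
functors. -/
theorem LDense.exists_extension {X Y Z : TCat Θ} {j : X ⟶ Y} (hj : LDense j)
    (hj' : FullyFaithful j) (hs : Z.LSeparated) (hc : Z.LComplete) (f : X ⟶ Z) :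
    ∃ g : Y ⟶ Z, j ≫ g = f := by
  have hj1 : Θ.kleisli (Y.lowerStar j.toFun) (Y.upperStar j.toFun) = Y.str := hj
  have hf1 := isTModule_lowerStar f
  have hf2 := isTModule_upperStar f
  have hadj : ModuleAdj Y Z (Θ.kleisli (Z.lowerStar f.toFun) (Y.upperStar j.toFun))
      (Θ.kleisli (Y.lowerStar j.toFun) (Z.upperStar f.toFun)) := by
    refine ⟨(isTModule_upperStar j).kleisli hf1, hf2.kleisli (isTModule_lowerStar j), ?_, ?_⟩
    · intro t y
      rw [← kleisli_assoc, kleisli_assoc (b := Z.lowerStar _), ← hj1]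
      refine Θ.kleisli_mono (fun _ _ => le_rfl) (fun s x => ?_) t y
      conv_lhs => rw [← (isTModule_upperStar j).str_kleisli]
      exact Θ.kleisli_mono (moduleAdj_star f).2.2.1 (fun _ _ => le_rfl) s x
    · intro t z
      rw [← kleisli_assoc, kleisli_assoc (b := Y.lowerStar _), hj'.kleisli_upperStar_lowerStar,
        hf2.str_kleisli]
      exact kleisli_lowerStar_upperStar_le f t z
  obtain ⟨g, -, hg⟩ := hc Y _ _ hadj
  have h1 : Z.upperStar (j ≫ g).toFun = Z.upperStar f.toFun := by
    have h2 := (isTModule_upperStar g).upperStar_kleisli j.toFun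
    rw [← hg, kleisli_assoc, hj'.kleisli_upperStar_lowerStar, hf2.str_kleisli] at h2
    funext t x
    have h3 := congrFun (congrFun h2 t) x
    rw [hg] at h3
    exact h3.symm
  exact ⟨g, hs X _ _ (fun t x => (congrFun (congrFun h1 t) x).le)
    (fun t x => (congrFun (congrFun h1 t) x).ge)⟩

end TCat

variable {Θ : StrictTopologicalTheory V}

theorem isReflectionMap_of_lDense {X : CatSep Θ} {Y : CatCompl Θ}
    (j : X ⟶ (complInclusion Θ).obj Y) (hj : TCat.FullyFaithful j.hom) (hj' : TCat.LDense j.hom) :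
    IsReflectionMap j := by
  intro Z f
  obtain ⟨g, hg⟩ := hj'.exists_extension hj Z.obj.property Z.property f.hom
  refine ⟨ObjectProperty.homMk (ObjectProperty.homMk g), ?_, fun g' hg' => ?_⟩
  · exact ObjectProperty.hom_ext _ hg
  · refine ObjectProperty.hom_ext _ (ObjectProperty.hom_ext _ ?_)
    refine hj'.eq_of_comp_eq Z.obj.property ?_
    exact (congrArg (fun k => k.hom) hg').trans hg.symm

theorem epi_of_lDense {X Y : CatSep Θ} (j : X ⟶ Y) (hj : TCat.LDense j.hom) : Epi j where
  left_cancellation {Z} _ _ hgh :=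
    ObjectProperty.hom_ext _ (hj.eq_of_comp_eq Z.property (congrArg (fun k => k.hom) hgh))

/-- The completion `X̃`, as an L-complete L-separated `T`-category. -/
abbrev completion (X : CatSep Θ) : CatCompl Θ :=
  ⟨⟨X.obj.tilde, X.obj.lSeparated_tilde⟩, X.obj.lComplete_tilde⟩

/-- The Yoneda functor, as the unit of the completion. -/
abbrev completionUnit (X : CatSep Θ) : X ⟶ (complInclusion Θ).obj (completion X) :=
  ObjectProperty.homMk X.obj.yonedaTilde

theorem isReflectionMap_completionUnit (X : CatSep Θ) : IsReflectionMap (completionUnit X) :=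
  isReflectionMap_of_lDense _ X.obj.fullyFaithful_yonedaTilde X.obj.lDense_yonedaTilde

/-- The bijection between functors out of the completion and functors out of `X`. -/
noncomputable def completionHomEquiv (X : CatSep Θ) (Y : CatCompl Θ) :
    (completion X ⟶ Y) ≃ (X ⟶ (complInclusion Θ).obj Y) :=
  Equiv.ofBijective (fun g => completionUnit X ≫ (complInclusion Θ).map g)
    ((Function.bijective_iff_existsUnique _).2 fun f => isReflectionMap_completionUnit X Y f)

theorem completionHomEquiv_comp (X : CatSep Θ) (Y Y' : CatCompl Θ) (g : Y ⟶ Y')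
    (h : completion X ⟶ Y) : completionHomEquiv X Y' (h ≫ g) =
      completionHomEquiv X Y h ≫ (complInclusion Θ).map g := rfl

end StrictTopologicalTheory

theorem mainTheorem1 {V : Type u} [CompleteLattice V] [CommMonoid V] [IsQuantale V]
    (Θ : StrictTopologicalTheory V) :
    -- the L-complete objects form an epi-reflective full subcategory
    (∃ r : Reflective Θ.complInclusion, ∀ X : Θ.CatSep, Epi (r.adj.unit.app X)) ∧
    -- every full L-dense embedding into an L-complete L-separated object is a reflection map
    (∀ (X : Θ.CatSep) (Y : Θ.CatCompl) (j : X ⟶ Θ.complInclusion.obj Y),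
      StrictTopologicalTheory.TCat.FullEmbedding j.hom →
      StrictTopologicalTheory.TCat.LDense j.hom →
        StrictTopologicalTheory.IsReflectionMap j) ∧
    -- the Yoneda functor into the L-closure of its image is such an embedding
    (∀ X : Θ.CatSep,
      StrictTopologicalTheory.TCat.FullEmbedding X.obj.yonedaTilde ∧
      StrictTopologicalTheory.TCat.LDense X.obj.yonedaTilde ∧
      ∃ (hs : X.obj.tilde.LSeparated) (hc : X.obj.tilde.LComplete),
        StrictTopologicalTheory.IsReflectionMap (X := X) (Y := ⟨⟨X.obj.tilde, hs⟩, hc⟩)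
          (ObjectProperty.homMk X.obj.yonedaTilde)) := by
  open StrictTopologicalTheory in
  refine ⟨⟨{ L := Adjunction.leftAdjointOfEquiv completionHomEquiv completionHomEquiv_comp
             adj := Adjunction.adjunctionOfEquivLeft completionHomEquiv
               completionHomEquiv_comp }, fun X => ?_⟩, fun X Y j hj hj' => ?_, fun X => ?_⟩
  · change Epi ((Adjunction.adjunctionOfEquivLeft completionHomEquiv
      completionHomEquiv_comp).unit.app X)
    rw [show (Adjunction.adjunctionOfEquivLeft completionHomEquiv
        completionHomEquiv_comp).unit.app X = completionUnit X from ?_]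
    · exact epi_of_lDense _ X.obj.lDense_yonedaTilde
    · simp [completionHomEquiv]
  · exact isReflectionMap_of_lDense j hj.1 hj'
  · exact ⟨TCat.fullEmbedding_yonedaTilde X.property, X.obj.lDense_yonedaTilde,
      X.obj.lSeparated_tilde, X.obj.lComplete_tilde, isReflectionMap_completionUnit X⟩
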